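/- All vector spaces are complex. For a Hilbert space $K$, the norm on $M_\nu(\mathcal B(K))$ is that of $\mathcal B(K^\nu)$. A unital operator space is a vector space $E$ with a norm on each $M_\nu(E)$, $\nu\ge 1$, and an element $e\in E$, for which there are a Hilbert space $K$ and a linear map $u\colon E\to\mathcal B(K)$ with $u(e)=I_K$ such that every $u_\nu\colon [a_{ij}]\mapsto[u(a_{ij})]$ is isometric. A linear map $\varphi$ between unital operator spaces is ucc (resp. ucis) if it preserves the units and every $\varphi_\nu$ is contractive (resp. isometric). A unital operator space $E$ is injective if for all unital operator spaces $Z\subseteq Y$ (with the same unit and the inherited matrix norms) every ucc map $Z\to E$ extends to a ucc map $Y\to E$. An injective envelope of a unital operator space $X$ is a pair $(S,\iota)$, where $S$ is an injective unital operator space, $\iota\colon X\to S$ is a ucis map, and no proper linear subspace of $S$ containing $\iota(X)$ is injective (with the inherited structure). Let $H$ be a Hilbert space and let $X\subseteq\mathcal B(H)$ be a linear subspace with $I_H\in X$. A boundary subsystem for $X$ in $\mathcal B(H)$ is a selfadjoint linear subspace $\mathcal I\subseteq\mathcal B(H)$ such that the restriction to $X$ of the quotient map $\mathcal B(H)\to\mathcal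 B(H)/\mathcal I$ is completely isometric, i.e. $$\inf\{\|[x_{ij}+y_{ij}]\| : y_{ij}\in\mathcal I\}=\|[x_{ij}]\|\qquad\text{for all }\nu\ge 1,\ [x_{ij}]\in M_\nu(X).$$ It is maximal if it is not properly contained in another boundary subsystem for $X$ in $\mathcal B(H)$. **Proposition.** A linear subspace $\mathcal I$ of $\mathcal B(H)$ is a maximal boundary subsystem for $X$ in $\mathcal B(H)$ if and only if there are an injective envelope $(S,\iota)$ of $X$ and a ucc map $\varphi\colon\mathcal B(H)\to S$ such that $\varphi(x)=\iota(x)$ for all $x\in X$ and $\mathcal I=\ker\varphi$. -/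

import Mathlib

universe u

noncomputable section

/-- The operator on the Hilbert space `K ^ n` (the `ℓ²`-sum of `n` copies of `K`) given by an
`n × n` matrix of bounded operators on `K`. -/
def matrixOp {K : Type u} [NormedAddCommGroup K] [InnerProductSpace ℂ K] {n : ℕ}
    (a : Matrix (Fin n) (Fin n) (K →L[ℂ] K)) :
    PiLp 2 (fun _ : Fin n => K) →L[ℂ] PiLp 2 (fun _ : Fin n => K) :=
  ((PiLp.continuousLinearEquiv 2 ℂ (fun _ : Fin n => K)).symm :
      (Fin n → K) →L[ℂ] PiLp 2 (fun _ : Fin n => K)) ∘L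
    ContinuousLinearMap.pi fun i => ∑ j, a i j ∘L PiLp.proj 2 (fun _ : Fin n => K) j

theorem matrixOp_apply {K : Type u} [NormedAddCommGroup K] [InnerProductSpace ℂ K] {n : ℕ}
    (a : Matrix (Fin n) (Fin n) (K →L[ℂ] K)) (v : PiLp 2 (fun _ : Fin n => K)) (i : Fin n) :
    matrixOp a v i = ∑ j, a i j (v j) := by
  simp [matrixOp]

/-- A unital operator space structure on a complex vector space `E`: a norm on every `M_n(E)` and
a distinguished element `unit`, such that some linear map of `E` into the bounded operators on a
Hilbert space is isometric on all matrix levels and maps `unit` to the identity operator.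
(Injectivity of that map says that `matNorm n` is a norm and not only a seminorm.) -/
structure UnitalOperatorSpace (E : Type u) [AddCommGroup E] [Module ℂ E] where
  matNorm : ∀ n : ℕ, Matrix (Fin n) (Fin n) E → ℝ
  unit : E
  exists_rep : ∃ (K : Type u) (_ : NormedAddCommGroup K) (_ : InnerProductSpace ℂ K)
    (_ : CompleteSpace K) (r : E →ₗ[ℂ] (K →L[ℂ] K)),
    Function.Injective r ∧ r unit = 1 ∧
      ∀ (n : ℕ) (a : Matrix (Fin n) (Fin n) E), ‖matrixOp (a.map r)‖ = matNorm n a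

/-- The unital operator space `B(H)`. -/
def boundedOperators (H : Type u) [NormedAddCommGroup H] [InnerProductSpace ℂ H]
    [CompleteSpace H] : UnitalOperatorSpace (H →L[ℂ] H) where
  matNorm _ a := ‖matrixOp a‖
  unit := 1
  exists_rep := ⟨H, inferInstance, inferInstance, inferInstance, LinearMap.id,
    Function.injective_id, rfl, fun _ _ => rfl⟩

/-- A linear subspace that contains the unit, with the inherited matrix norms and unit. -/
def UnitalOperatorSpace.restrict {E : Type u} [AddCommGroup E] [Module ℂ E]
    (𝓔 : UnitalOperatorSpace E) (V : Submodule ℂ E) (hV : 𝓔.unit ∈ V) :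
    UnitalOperatorSpace V where
  matNorm n a := 𝓔.matNorm n (a.map (fun v : V => (v : E)))
  unit := ⟨𝓔.unit, hV⟩
  exists_rep := by
    obtain ⟨K, i₁, i₂, i₃, r, hi, hr, hn⟩ := 𝓔.exists_rep
    exact ⟨K, i₁, i₂, i₃, r ∘ₗ V.subtype, hi.comp Subtype.val_injective, hr, fun n a => hn n (a.map (fun v : V => (v : E)))⟩

/-- Unital completely contractive linear maps. -/
def IsUCC {E F : Type u} [AddCommGroup E] [Module ℂ E] [AddCommGroup F] [Module ℂ F]
    (𝓔 : UnitalOperatorSpace E) (𝓕 : UnitalOperatorSpace F) (φ : E →ₗ[ℂ] F) : Prop :=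
  φ 𝓔.unit = 𝓕.unit ∧
    ∀ (n : ℕ) (a : Matrix (Fin n) (Fin n) E), 𝓕.matNorm n (a.map φ) ≤ 𝓔.matNorm n a

/-- Unital completely isometric linear maps. -/
def IsUCIS {E F : Type u} [AddCommGroup E] [Module ℂ E] [AddCommGroup F] [Module ℂ F]
    (𝓔 : UnitalOperatorSpace E) (𝓕 : UnitalOperatorSpace F) (φ : E →ₗ[ℂ] F) : Prop :=
  φ 𝓔.unit = 𝓕.unit ∧
    ∀ (n : ℕ) (a : Matrix (Fin n) (Fin n) E), 𝓕.matNorm n (a.map φ) = 𝓔.matNorm n a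

/-- `E` is injective: for unital operator spaces `Z ⊆ Y` (with the same unit), every ucc map
`Z → E` extends to a ucc map `Y → E`. -/
def UnitalOperatorSpace.IsInjective {E : Type u} [AddCommGroup E] [Module ℂ E]
    (𝓔 : UnitalOperatorSpace E) : Prop :=
  ∀ (Y : Type u) [AddCommGroup Y] [Module ℂ Y] (𝓨 : UnitalOperatorSpace Y)
    (Z : Submodule ℂ Y) (hZ : 𝓨.unit ∈ Z) (φ : Z →ₗ[ℂ] E),
    IsUCC (𝓨.restrict Z hZ) 𝓔 φ →
      ∃ ψ : Y →ₗ[ℂ] E, IsUCC 𝓨 𝓔 ψ ∧ ∀ z : Z, ψ z = φ z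

/-- `(S, ι)` is an injective envelope of `X`: `ι` is a ucis map, `S` is injective, and no proper
linear subspace of `S` that contains `ι(X)` is injective. -/
def IsInjectiveEnvelope {X S : Type u} [AddCommGroup X] [Module ℂ X] [AddCommGroup S]
    [Module ℂ S] (𝓧 : UnitalOperatorSpace X) (𝓢 : UnitalOperatorSpace S) (ι : X →ₗ[ℂ] S) :
    Prop :=
  IsUCIS 𝓧 𝓢 ι ∧ 𝓢.IsInjective ∧
    ∀ (V : Submodule ℂ S) (hV : 𝓢.unit ∈ V),
      LinearMap.range ι ≤ V → (𝓢.restrict V hV).IsInjective → V = ⊤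

/-- The quotient norm of `[a i j + I]` in `M_n(B(H) / I) = M_n(B(H)) / M_n(I)`. -/
def quotientMatNorm {H : Type u} [NormedAddCommGroup H] [InnerProductSpace ℂ H]
    (I : Submodule ℂ (H →L[ℂ] H)) {n : ℕ} (a : Matrix (Fin n) (Fin n) (H →L[ℂ] H)) : ℝ :=
  ⨅ y : Matrix (Fin n) (Fin n) I, ‖matrixOp (a + y.map (fun v : I => (v : H →L[ℂ] H)))‖

/-- `I` is a boundary subsystem for `X` in `B(H)`: a selfadjoint linear subspace such that the
restriction to `X` of the quotient map `B(H) → B(H) / I` is completely isometric. -/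
def IsBoundarySubsystem {H : Type u} [NormedAddCommGroup H] [InnerProductSpace ℂ H]
    [CompleteSpace H] (X I : Submodule ℂ (H →L[ℂ] H)) : Prop :=
  (∀ a ∈ I, star a ∈ I) ∧
    ∀ (n : ℕ) (x : Matrix (Fin n) (Fin n) (H →L[ℂ] H)), (∀ i j, x i j ∈ X) →
      quotientMatNorm I x = ‖matrixOp x‖

end

/-! Let `(S, ι)` be an injective envelope of X. If I is a boundary subsystem, then x + y ↦ ι(x) on X
+ I is well defined and completely contractive, because B(H) → B(H)/I is completely isometric on X.
Injectivity of S extends it to a ucc map on B(H) whose kernel contains I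
(`IsBoundarySubsystem.exists_le_ker`). Conversely, the kernel of any ucc extension of ι is a
boundary subsystem (`isBoundarySubsystem_ker`). Hence a maximal I is such a kernel.

Maximality of every such kernel comes from rigidity: a ucc self-map of S that fixes ι(X) is the
identity. Extend ι(x) ↦ x to a ucc map θ from S to B(H), using that B(H) is injective. Then φ ∘ θ =
id = ψ ∘ θ for any two ucc extensions φ, ψ of ι. As b - θ(φ(b)) lies in ker φ, the inclusion ker φ ⊆
ker ψ forces ψ = φ.

The definition of an envelope asks only for minimality among injective subspaces, so rigidity has to
be proved. Injectivity of B(H) is Arveson's theorem (`exists_arveson_extension`). By compactness,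
some ucc self-map of B(H) fixing X has a minimal seminorm b ↦ ‖φ b‖; its range is a rigid envelope
(`exists_rigid_isInjectiveEnvelope`), and `IsInjectiveEnvelope.isRigid` carries rigidity to all
others. -/

/-! ### Matrix norms, and positivity deduced from norm estimates. -/

section MatrixOperators

variable {K : Type u} [NormedAddCommGroup K] [InnerProductSpace ℂ K]

/-- `matrixOp` as a linear map. -/
noncomputable def matrixOpₗ (n : ℕ) : Matrix (Fin n) (Fin n) (K →L[ℂ] K) →ₗ[ℂ]
    (PiLp 2 (fun _ : Fin n => K) →L[ℂ] PiLp 2 (fun _ : Fin n => K)) where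
  toFun := matrixOp
  map_add' a b := by
    ext v i
    simp [matrixOp_apply, Finset.sum_add_distrib]
  map_smul' c a := by
    ext v i
    simp [matrixOp_apply, Finset.smul_sum]

theorem matrixOpₗ_apply {n : ℕ} (a : Matrix (Fin n) (Fin n) (K →L[ℂ] K)) :
    matrixOpₗ n a = matrixOp a := rfl

theorem inner_matrixOp {n : ℕ} (a : Matrix (Fin n) (Fin n) (K →L[ℂ] K))
    (v w : PiLp 2 (fun _ : Fin n => K)) :
    inner ℂ w (matrixOp a v) = ∑ i, ∑ j, inner ℂ (w i) (a i j (v j)) := by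
  simp [PiLp.inner_apply, matrixOp_apply, inner_sum]

theorem matrixOp_diagonal_one (n : ℕ) :
    matrixOp (Matrix.diagonal fun _ : Fin n => (1 : K →L[ℂ] K)) = 1 := by
  ext v i
  simp only [matrixOp_apply, one_apply_eq_self]
  rw [Finset.sum_eq_single i]
  · simp
  · intro j _ hj
    simp [Matrix.diagonal_apply_ne' _ hj]
  · simp

theorem norm_matrixOp_one_by_one (a : K →L[ℂ] K) :
    ‖matrixOp (fun _ _ : Fin 1 => a)‖ = ‖a‖ := by
  have hn : ∀ v : PiLp 2 (fun _ : Fin 1 => K), ‖v‖ = ‖v 0‖ := fun v => by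
    simp [PiLp.norm_eq_of_L2]
  have hm : ∀ v, matrixOp (fun _ _ : Fin 1 => a) v 0 = a (v 0) := fun v => by
    simpa using matrixOp_apply (fun _ _ : Fin 1 => a) v 0
  apply le_antisymm
  · refine ContinuousLinearMap.opNorm_le_bound _ (norm_nonneg _) fun v => ?_
    rw [hn, hn, hm]
    exact a.le_opNorm (v 0)
  · refine ContinuousLinearMap.opNorm_le_bound _ (norm_nonneg (matrixOp fun _ _ : Fin 1 => a))
      fun v => ?_
    have := (matrixOp (fun _ _ : Fin 1 => a)).le_opNorm (WithLp.toLp 2 fun _ => v)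
    rwa [hn, hn, hm] at this

/-- A bound for the operator norm by a bound for the real parts of the matrix coefficients. -/
theorem ContinuousLinearMap.opNorm_le_of_re_inner {L : Type*} [NormedAddCommGroup L]
    [InnerProductSpace ℂ L] (A : L →L[ℂ] L) {C : ℝ} (hC : 0 ≤ C)
    (h : ∀ v w, 0 ≤ C * (‖v‖ ^ 2 + ‖w‖ ^ 2) + 2 * (inner ℂ w (A v)).re) : ‖A‖ ≤ C := by
  refine ContinuousLinearMap.opNorm_le_of_re_inner_le hC fun v w hv hw => ?_
  have := h v (-w)
  rw [norm_neg, hv, hw, inner_neg_left, Complex.neg_re, ← inner_conj_symm, Complex.conj_re] at this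
  rw [RCLike.re_eq_complex_re]
  linarith

/-- A functional on bounded operators that attains its norm at the identity is nonnegative on
accretive operators. -/
theorem re_nonneg_of_accretive {L : Type*} [NormedAddCommGroup L] [InnerProductSpace ℂ L]
    (s : (L →L[ℂ] L) →ₗ[ℂ] ℂ) {c : ℝ} (hs : ∀ T, ‖s T‖ ≤ c * ‖T‖) (h1 : s 1 = c)
    (hc : 0 ≤ c) (T : L →L[ℂ] L) (hT : ∀ x, 0 ≤ (inner ℂ x (T x)).re) : 0 ≤ (s T).re := by
  have key : ∀ t : ℝ, 0 < t → -(s T).re ≤ t * (c * ‖T‖ ^ 2) := by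
    intro t ht
    -- Accretivity removes the first-order term in t, so the norm exceeds 1 only to second order.
    have hn : ‖(1 : L →L[ℂ] L) - (t : ℂ) • T‖ ≤ 1 + t ^ 2 * ‖T‖ ^ 2 := by
      refine ContinuousLinearMap.opNorm_le_bound _ (by positivity) fun x => ?_
      have e : ‖((1 : L →L[ℂ] L) - (t : ℂ) • T) x‖ ^ 2 ≤ (1 + t ^ 2 * ‖T‖ ^ 2) * ‖x‖ ^ 2 := by
        have := norm_sub_sq (𝕜 := ℂ) x ((t : ℂ) • T x)
        simp only [sub_apply, one_apply_eq_self,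
          smul_apply]
        rw [this, inner_smul_right, norm_smul]
        have h2 : ‖T x‖ ^ 2 ≤ (‖T‖ * ‖x‖) ^ 2 := by
          gcongr; exact T.le_opNorm x
        have h3 := mul_nonneg ht.le (hT x)
        simp only [RCLike.re_eq_complex_re, Complex.mul_re, Complex.ofReal_re, Complex.ofReal_im,
          Complex.norm_real, mul_pow, zero_mul, sub_zero, Real.norm_eq_abs, sq_abs] at *
        nlinarith [mul_le_mul_of_nonneg_left h2 (sq_nonneg t)]
      refine abs_le_of_sq_le_sq' ?_ (by positivity) |>.2
      refine e.trans ?_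
      rw [mul_pow]
      gcongr
      have : 0 ≤ t ^ 2 * ‖T‖ ^ 2 := by positivity
      nlinarith
    have h2 := (Complex.re_le_norm _).trans (hs (1 - (t : ℂ) • T))
    rw [map_sub, map_smul, h1] at h2
    have h3 := mul_le_mul_of_nonneg_left hn hc
    rw [Complex.sub_re, Complex.ofReal_re, smul_eq_mul, Complex.re_ofReal_mul] at h2
    have : t * -(s T).re ≤ t * (t * (c * ‖T‖ ^ 2)) := by nlinarith
    exact le_of_mul_le_mul_left this ht
  by_contra! hneg
  set M := c * ‖T‖ ^ 2
  have hM : 0 ≤ M := by positivity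
  -- With this t, `key` bounds the positive number -Re s(T) by less than half of itself.
  have := key (-(s T).re / (2 * (M + 1))) (by apply div_pos <;> linarith)
  rw [div_mul_eq_mul_div, le_div_iff₀ (by linarith)] at this
  nlinarith

/-- A unital contraction between algebras of bounded operators preserves adjoints. -/
theorem map_star_of_unital_contraction {L : Type*} [NormedAddCommGroup L] [InnerProductSpace ℂ L]
    [CompleteSpace L] [CompleteSpace K] (φ : (L →L[ℂ] L) →ₗ[ℂ] (K →L[ℂ] K)) (h1 : φ 1 = 1)
    (hφ : ∀ a, ‖φ a‖ ≤ ‖a‖) (a : L →L[ℂ] L) : φ (star a) = star (φ a) := by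
  have hacc : ∀ T : L →L[ℂ] L, (∀ x, 0 ≤ (inner ℂ x (T x)).re) →
      ∀ v, 0 ≤ (inner ℂ v (φ T v)).re := by
    intro T hT v
    let s : (L →L[ℂ] L) →ₗ[ℂ] ℂ :=
      { toFun := fun T => inner ℂ v (φ T v)
        map_add' := by intro x y; simp
        map_smul' := by intro x y; simp }
    refine re_nonneg_of_accretive s (c := ‖v‖ ^ 2) (fun T => ?_) ?_ (by positivity) T hT
    · calc ‖inner ℂ v (φ T v)‖ ≤ ‖v‖ * ‖φ T v‖ := norm_inner_le_norm _ _
        _ ≤ ‖v‖ * (‖φ T‖ * ‖v‖) := by gcongr; exact (φ T).le_opNorm v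
        _ ≤ ‖v‖ * (‖T‖ * ‖v‖) := by gcongr; exact hφ T
        _ = _ := by ring
    · simp [s, h1]
  have hsa : ∀ b : L →L[ℂ] L, IsSelfAdjoint b → IsSelfAdjoint (φ b) := by
    intro b hb
    rw [ContinuousLinearMap.isSelfAdjoint_iff_isSymmetric] at hb ⊢
    rw [LinearMap.isSymmetric_iff_inner_map_self_real]
    intro v
    have him : ∀ x, (inner ℂ x (b x)).im = 0 := fun x => by
      simpa using hb.im_inner_self_apply x
    -- Both i b and -i b are accretive, with real part zero, so Im ⟨v, φ(b) v⟩ has both signs.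
    have h1 := hacc (Complex.I • b) (fun x => by simp [him]) v
    have h2 := hacc (-Complex.I • b) (fun x => by simp [him, inner_smul_right]) v
    simp [inner_smul_right] at h1 h2
    have h0 : (inner ℂ v (φ b v)).im = 0 := le_antisymm (by linarith) (by linarith)
    rw [inner_conj_symm]
    exact (Complex.conj_eq_iff_im.2 h0).symm.trans (inner_conj_symm _ _)
  have hre := hsa _ (realPart a).2
  have him := hsa _ (imaginaryPart a).2
  rw [← realPart_add_I_smul_imaginaryPart a]
  simp only [map_add, map_smul, star_add, star_smul, (realPart a).2.star_eq,
    (imaginaryPart a).2.star_eq, hre.star_eq, him.star_eq]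

end MatrixOperators

/-! ### Hahn–Banach extension and weak operator limits. -/

/-- Hahn–Banach extension along a linear map. -/
theorem exists_extension_along {V E : Type*} [AddCommGroup V] [Module ℂ V]
    [NormedAddCommGroup E] [NormedSpace ℂ E] (T : V →ₗ[ℂ] E) (g : V →ₗ[ℂ] ℂ) {c : ℝ} (hc : 0 ≤ c)
    (h : ∀ v, ‖g v‖ ≤ c * ‖T v‖) :
    ∃ s : E →ₗ[ℂ] ℂ, (∀ v, s (T v) = g v) ∧ ∀ y, ‖s y‖ ≤ c * ‖y‖ := by
  obtain ⟨p, hp⟩ := T.rangeRestrict.exists_rightInverse_of_surjective T.range_rangeRestrict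
  have hp' : ∀ y, T (p y) = y := fun y => congrArg Subtype.val (LinearMap.congr_fun hp y)
  let g' : LinearMap.range T →L[ℂ] ℂ := (g ∘ₗ p).mkContinuous c fun y => by
    simpa [hp'] using h (p y)
  obtain ⟨s, hs, hn⟩ := exists_extension_norm_eq (LinearMap.range T) g'
  refine ⟨s, fun v => ?_, fun y => ?_⟩
  · have h1 : s (T v) = g (p ⟨T v, v, rfl⟩) := hs ⟨T v, v, rfl⟩
    -- The bound makes `g` vanish on ker T, so the choice of section `p` does not matter.
    have h2 := h (p ⟨T v, v, rfl⟩ - v)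
    rw [map_sub T, hp', sub_self, norm_zero, mul_zero, norm_le_zero_iff, map_sub, sub_eq_zero] at h2
    exact h1.trans h2
  · have : ‖s‖ ≤ c := hn ▸ LinearMap.mkContinuous_norm_le _ hc _
    exact s.le_of_opNorm_le this y

/-- A pointwise bounded family of linear maps into bounded operators has a limit along an
ultrafilter, for pointwise weak operator convergence. -/
theorem exists_weak_limit {ι E : Type*} [AddCommGroup E] [Module ℂ E] {K : Type u}
    [NormedAddCommGroup K] [InnerProductSpace ℂ K] [CompleteSpace K] (U : Ultrafilter ι)
    (f : ι → E →ₗ[ℂ] (K →L[ℂ] K)) (C : E → ℝ) (hC : ∀ i a, ‖f i a‖ ≤ C a) :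
    ∃ g : E →ₗ[ℂ] (K →L[ℂ] K), ∀ a v w,
      Filter.Tendsto (fun i => inner ℂ w (f i a v)) U (nhds (inner ℂ w (g a v))) := by
  have hb : ∀ i a v w, ‖inner ℂ w (f i a v)‖ ≤ C a * ‖v‖ * ‖w‖ := fun i a v w =>
    calc _ ≤ ‖w‖ * ‖f i a v‖ := norm_inner_le_norm _ _
      _ ≤ ‖w‖ * (C a * ‖v‖) := by gcongr; exact (f i a).le_of_opNorm_le (hC i a) v
      _ = _ := by ring
  have hlim : ∀ a v w, ∃ z, Filter.Tendsto (fun i => inner ℂ w (f i a v)) U (nhds z) := by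
    intro a v w
    obtain ⟨z, -, hz⟩ := (isCompact_closedBall (0 : ℂ) (C a * ‖v‖ * ‖w‖)).ultrafilter_le_nhds
      (U.map fun i => inner ℂ w (f i a v))
      (Filter.le_principal_iff.2 (Filter.mem_map.2 (Filter.univ_mem' fun i => by
        simpa using hb i a v w)))
    exact ⟨z, hz⟩
  choose B hB using hlim
  have hBn : ∀ a v w, ‖B a v w‖ ≤ C a * ‖v‖ * ‖w‖ := fun a v w =>
    le_of_tendsto (hB a v w).norm (Filter.Eventually.of_forall fun i => hb i a v w)
  have huniq : ∀ {a v w z}, Filter.Tendsto (fun i => inner ℂ w (f i a v)) U (nhds z) →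
      B a v w = z := fun h => tendsto_nhds_unique (hB _ _ _) h
  let S : E → K →L⋆[ℂ] K →L[ℂ] ℂ := fun a => LinearMap.mkContinuous₂
    (LinearMap.mk₂'ₛₗ (starRingEnd ℂ) (RingHom.id ℂ) (fun w v => B a v w)
      (fun w w' v => huniq (by simpa [inner_add_left] using (hB a v w).add (hB a v w')))
      (fun c w v => huniq (by simpa [inner_smul_left, mul_comm] using (hB a v w).const_mul ((starRingEnd ℂ) c)))
      (fun w v v' => huniq (by simpa [inner_add_right] using (hB a v w).add (hB a v' w)))
      (fun c w v => huniq (by simpa [inner_smul_right] using (hB a v w).const_mul c)))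
    (C a) (fun w v => by simpa [mul_right_comm] using hBn a v w)
  have hS : ∀ a v w, S a w v = B a v w := fun a v w => rfl
  -- The Riesz operator of the form puts w on the operator side; the adjoint moves it to v.
  let G : E → K →L[ℂ] K := fun a =>
    ContinuousLinearMap.adjoint (InnerProductSpace.continuousLinearMapOfBilin (S a))
  have hG : ∀ a v w, inner ℂ w (G a v) = B a v w := by
    intro a v w
    rw [ContinuousLinearMap.adjoint_inner_right,
      InnerProductSpace.continuousLinearMapOfBilin_apply, hS]
  refine ⟨{ toFun := G, map_add' := fun a b => ?_, map_smul' := fun c a => ?_ },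
    fun a v w => ?_⟩
  · ext v
    refine ext_inner_left ℂ fun w => ?_
    rw [add_apply, inner_add_right, hG, hG, hG]
    exact huniq (by simpa [inner_add_right] using (hB a v w).add (hB b v w))
  · ext v
    refine ext_inner_left ℂ fun w => ?_
    rw [RingHom.id_apply, smul_apply, inner_smul_right, hG, hG]
    exact huniq (by simpa [inner_smul_right] using (hB a v w).const_mul c)
  · change Filter.Tendsto _ _ (nhds (inner ℂ w (G a v)))
    rw [hG]
    exact hB a v w

/-- Bounds on matrix norms pass to weak limits. -/
theorem norm_matrixOp_le_of_tendsto {ι E : Type*} {K : Type u} [NormedAddCommGroup K]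
    [InnerProductSpace ℂ K] {U : Filter ι} [U.NeBot] {f : ι → E → K →L[ℂ] K}
    {g : E → K →L[ℂ] K}
    (hg : ∀ a v w, Filter.Tendsto (fun i => inner ℂ w (f i a v)) U (nhds (inner ℂ w (g a v))))
    {n : ℕ} {a : Matrix (Fin n) (Fin n) E} {C : ℝ} (h : ∀ᶠ i in U, ‖matrixOp (a.map (f i))‖ ≤ C) :
    ‖matrixOp (a.map g)‖ ≤ C := by
  -- One index is enough to know 0 ≤ C.
  obtain ⟨i₀, hi₀⟩ := h.exists
  refine ContinuousLinearMap.opNorm_le_of_re_inner_le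
    ((norm_nonneg (matrixOp (a.map (f i₀)))).trans hi₀) fun x y hx hy => ?_
  have hlim : Filter.Tendsto (fun i => inner ℂ y (matrixOp (a.map (f i)) x)) U
      (nhds (inner ℂ y (matrixOp (a.map g) x))) := by
    simp only [inner_matrixOp, Matrix.map_apply]
    exact tendsto_finsetSum _ fun k _ => tendsto_finsetSum _ fun l _ => hg _ _ _
  rw [inner_re_symm]
  refine (RCLike.re_le_norm _).trans (le_of_tendsto hlim.norm ?_)
  filter_upwards [h] with i hi
  calc _ ≤ ‖y‖ * ‖matrixOp (a.map (f i)) x‖ := norm_inner_le_norm _ _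
    _ ≤ 1 * (C * 1) := by
      rw [hy, ← hx]; gcongr; exact ContinuousLinearMap.le_of_opNorm_le _ hi x
    _ = C := by ring

/-! ### Arveson's extension theorem. -/

section Arveson

variable {H K : Type u} [NormedAddCommGroup H] [InnerProductSpace ℂ H]
  [NormedAddCommGroup K] [InnerProductSpace ℂ K]

/-- The operator matrix `a ⊗ |w⟩⟨v|`, in coordinates with respect to a finite family. -/
noncomputable def tensorMatrix {n : ℕ} (e : Fin n → H) (w v : H) :
    (K →L[ℂ] K) →ₗ[ℂ] Matrix (Fin n) (Fin n) (K →L[ℂ] K) where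
  toFun a i j := (inner ℂ w (e i) * inner ℂ (e j) v) • a
  map_add' a b := by funext i j; exact smul_add _ _ _
  map_smul' c a := by funext i j; exact smul_comm _ _ _

/-- The contraction of a vector of `K ^ n` against the coordinates of a vector of `H`. -/
noncomputable def contractVec {n : ℕ} (e : Fin n → H) (x : PiLp 2 (fun _ : Fin n => K)) (v : H) :
    K := ∑ j, (inner ℂ (e j) v : ℂ) • x j

/-- Reduces quadratic forms on K ^ n to forms on K; accretivity of `M` in `exists_finite_arveson` is
checked this way. -/
theorem inner_matrixOp_tensorMatrix {n : ℕ} (e : Fin n → H) (w v : H) (a : K →L[ℂ] K)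
    (x : PiLp 2 (fun _ : Fin n => K)) :
    inner ℂ x (matrixOp (tensorMatrix e w v a) x) =
      inner ℂ (contractVec e x w) (a (contractVec e x v)) := by
  have ht : ∀ i j y, tensorMatrix e w v a i j y = (inner ℂ w (e i) * inner ℂ (e j) v) • a y :=
    fun i j y => rfl
  simp only [inner_matrixOp, contractVec, map_sum, sum_inner, inner_sum, inner_smul_left,
    map_smul, inner_smul_right, inner_conj_symm, ht, Finset.mul_sum]
  rw [Finset.sum_comm]
  refine Finset.sum_congr rfl fun i _ => Finset.sum_congr rfl fun j _ => ?_
  ring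

/-- Extension of a completely contractive map, up to the compression to a finite orthonormal
family. -/
theorem exists_finite_arveson {W : Type u} [AddCommGroup W] [Module ℂ W]
    (r : W →ₗ[ℂ] (K →L[ℂ] K)) (f : W →ₗ[ℂ] (H →L[ℂ] H)) (u : W) (hr : r u = 1) (hf : f u = 1)
    (h : ∀ (n : ℕ) (a : Matrix (Fin n) (Fin n) W), ‖matrixOp (a.map f)‖ ≤ ‖matrixOp (a.map r)‖)
    {n : ℕ} (e : Fin n → H) (he : Orthonormal ℂ e) :
    ∃ Φ : (K →L[ℂ] K) →ₗ[ℂ] (H →L[ℂ] H),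
      (∀ (m : ℕ) (a : Matrix (Fin m) (Fin m) (K →L[ℂ] K)),
        ‖matrixOp (a.map Φ)‖ ≤ ‖matrixOp a‖) ∧
      ∀ (z : W) (v w : H), inner ℂ w (Φ (r z) v) =
        inner ℂ (∑ i, (inner ℂ (e i) w : ℂ) • e i) (f z (∑ j, (inner ℂ (e j) v : ℂ) • e j)) := by
  -- Pairing with the vector (e₁, …, eₙ) encodes the compressed map as one functional on M_n(W), so
  -- scalar Hahn–Banach suffices.
  let ê : PiLp 2 (fun _ : Fin n => H) := WithLp.toLp 2 e
  let T : Matrix (Fin n) (Fin n) W →ₗ[ℂ]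
    (PiLp 2 (fun _ : Fin n => K) →L[ℂ] PiLp 2 (fun _ : Fin n => K)) :=
    matrixOpₗ n ∘ₗ r.mapMatrix
  let g : Matrix (Fin n) (Fin n) W →ₗ[ℂ] ℂ :=
    { toFun := fun z => inner ℂ ê (matrixOpₗ n (f.mapMatrix z) ê)
      map_add' := fun x y => by simp only [map_add, add_apply, inner_add_right]
      map_smul' := fun c x => by
        simp only [map_smul, smul_apply, inner_smul_right, RingHom.id_apply, smul_eq_mul] }
  have hT : ∀ z, T z = matrixOp (z.map r) := fun z => rfl
  have hg : ∀ z, g z = ∑ i, ∑ j, inner ℂ (e i) (f (z i j) (e j)) := fun z =>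
    inner_matrixOp (z.map f) ê ê
  have hgT : ∀ z, ‖g z‖ ≤ ‖ê‖ ^ 2 * ‖T z‖ := fun z =>
    calc ‖g z‖ ≤ ‖ê‖ * ‖matrixOp (z.map f) ê‖ :=
        norm_inner_le_norm (𝕜 := ℂ) ê (matrixOp (z.map f) ê)
      _ ≤ ‖ê‖ * (‖matrixOp (z.map r)‖ * ‖ê‖) := by
        gcongr; exact (matrixOp (z.map f)).le_of_opNorm_le (h n z) ê
      _ = ‖ê‖ ^ 2 * ‖T z‖ := by rw [hT]; ring
  obtain ⟨s, hs, hsn⟩ := exists_extension_along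
    (E := PiLp 2 (fun _ : Fin n => K) →L[ℂ] PiLp 2 (fun _ : Fin n => K)) T g (sq_nonneg ‖ê‖) hgT
  -- The functional attains its norm bound at the identity, hence is nonnegative on accretive
  -- operators.
  have hs1 : s 1 = ((‖ê‖ ^ 2 : ℝ) : ℂ) := by
    have h1 : T (Matrix.diagonal fun _ => u) = 1 := by
      rw [hT, Matrix.diagonal_map (map_zero r), ← matrixOp_diagonal_one]
      simp [hr]
    have h2 : (Matrix.diagonal fun _ : Fin n => u).map f = Matrix.diagonal fun _ => 1 := by
      rw [Matrix.diagonal_map (map_zero f)]; simp [hf]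
    rw [← h1, hs]
    change inner ℂ ê (matrixOp ((Matrix.diagonal fun _ : Fin n => u).map f) ê) = _
    rw [h2, matrixOp_diagonal_one]
    simp [inner_self_eq_norm_sq_to_K]
  have hacc := re_nonneg_of_accretive s hsn hs1 (by positivity)
  -- Decoding the functional: Φ(a) = ∑ s(E_ij ⊗ a) |e_i⟩⟨e_j|.
  let Φ : (K →L[ℂ] K) →ₗ[ℂ] (H →L[ℂ] H) := ∑ i, ∑ j,
    (s ∘ₗ matrixOpₗ n ∘ₗ Matrix.singleLinearMap ℂ i j).smulRight
      ((innerSL ℂ (e j)).smulRight (e i))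
  have hΦ0 : ∀ a v w, inner ℂ w (Φ a v) = ∑ i, ∑ j, s (matrixOp (Matrix.single i j a)) *
      (inner ℂ (e j) v * inner ℂ w (e i)) := by
    intro a v w
    simp [Φ, LinearMap.sum_apply, matrixOpₗ_apply, Matrix.singleLinearMap]
  have hΦ : ∀ a v w, inner ℂ w (Φ a v) = s (matrixOp (tensorMatrix e w v a)) := by
    intro a v w
    rw [hΦ0]
    conv_rhs => rw [Matrix.matrix_eq_sum_single (tensorMatrix e w v a), ← matrixOpₗ_apply]
    simp only [map_sum]
    refine Finset.sum_congr rfl fun i _ => Finset.sum_congr rfl fun j _ => ?_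
    have : Matrix.single i j (tensorMatrix e w v a i j) =
        (inner ℂ w (e i) * inner ℂ (e j) v) • Matrix.single i j a := by
      rw [Matrix.smul_single]; rfl
    rw [this, map_smul, map_smul, smul_eq_mul, matrixOpₗ_apply]
    ring
  have hr' : ∀ z v w, inner ℂ w (Φ (r z) v) =
      inner ℂ (∑ i, (inner ℂ (e i) w : ℂ) • e i) (f z (∑ j, (inner ℂ (e j) v : ℂ) • e j)) := by
    intro z v w
    rw [hΦ0]
    simp only [map_sum, sum_inner, inner_sum, inner_smul_left, map_smul, inner_smul_right,
      inner_conj_symm, Finset.mul_sum]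
    rw [Finset.sum_comm]
    refine Finset.sum_congr rfl fun j _ => Finset.sum_congr rfl fun i _ => ?_
    have : s (matrixOp (Matrix.single i j (r z))) = inner ℂ (e i) (f z (e j)) := by
      have h1 : Matrix.single i j (r z) = (Matrix.single i j z).map r := by
        rw [Matrix.map_single]
      rw [h1, ← hT, hs, hg, Finset.sum_eq_single i, Finset.sum_eq_single j]
      · simp
      · intro k _ hk
        simp [Matrix.single_apply_of_col_ne _ _ hk.symm]
      · simp
      · intro k _ hk
        simp [Matrix.single_apply_of_row_ne hk.symm]
      · simp
    rw [this]
    ring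
  -- Φ(1) is the projection onto the span of the family; this is Bessel's inequality.
  have hone : ∀ v, (inner ℂ v (Φ 1 v)).re ≤ ‖v‖ ^ 2 := by
    intro v
    rw [← hr, hr', hf, one_apply_eq_self, he.inner_sum]
    refine le_trans (le_of_eq ?_) (he.sum_inner_products_le (s := Finset.univ) v)
    rw [Complex.re_sum]
    refine Finset.sum_congr rfl fun i _ => ?_
    rw [← Complex.normSq_eq_conj_mul_self, Complex.ofReal_re, Complex.normSq_eq_norm_sq]
  refine ⟨Φ, fun m a => ?_, hr'⟩
  refine ContinuousLinearMap.opNorm_le_of_re_inner _ (norm_nonneg (matrixOp a)) fun v w => ?_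
  set C := ‖matrixOp a‖
  have hC : 0 ≤ C := norm_nonneg (matrixOp a)
  -- Applying `s` to M gives the form to be bounded, with Φ(1) inserted. M is accretive: its real
  -- form at x is at least C (‖y‖ - ‖z‖)², with y, z the contractions of x against v, w.
  let M : Matrix (Fin n) (Fin n) (K →L[ℂ] K) :=
    (C : ℂ) • (∑ l, tensorMatrix e (v l) (v l) 1 + ∑ k, tensorMatrix e (w k) (w k) 1) +
      (2 : ℂ) • ∑ k, ∑ l, tensorMatrix e (w k) (v l) (a k l)
  have hM : matrixOp M = (C : ℂ) • (∑ l, matrixOp (tensorMatrix e (v l) (v l) 1) +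
      ∑ k, matrixOp (tensorMatrix e (w k) (w k) 1)) +
      (2 : ℂ) • ∑ k, ∑ l, matrixOp (tensorMatrix e (w k) (v l) (a k l)) := by
    simp only [← matrixOpₗ_apply, M, map_add, map_smul, map_sum]
  have hpos := hacc (matrixOp M) fun x => by
    let y : PiLp 2 (fun _ : Fin m => K) := WithLp.toLp 2 fun l => contractVec e x (v l)
    let z : PiLp 2 (fun _ : Fin m => K) := WithLp.toLp 2 fun l => contractVec e x (w l)
    have hx : inner ℂ x (matrixOp M x) = (C : ℂ) * (inner ℂ y y + inner ℂ z z) +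
        2 * inner ℂ z (matrixOp a y) := by
      rw [inner_matrixOp a y z]
      simp only [hM, add_apply, smul_apply, sum_apply, inner_add_right,
        inner_smul_right, inner_sum, inner_matrixOp_tensorMatrix, one_apply_eq_self]
      simp only [PiLp.inner_apply, y, z]
    have hyz : ‖inner ℂ z (matrixOp a y)‖ ≤ ‖z‖ * (C * ‖y‖) :=
      (norm_inner_le_norm _ _).trans (by gcongr; exact (matrixOp a).le_opNorm y)
    have hre := (abs_le.1 ((Complex.abs_re_le_norm _).trans hyz)).1
    have e1 : (inner ℂ y y).re = ‖y‖ ^ 2 := inner_self_eq_norm_sq (𝕜 := ℂ) y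
    have e2 : (inner ℂ z z).re = ‖z‖ ^ 2 := inner_self_eq_norm_sq (𝕜 := ℂ) z
    rw [hx, Complex.add_re, Complex.re_ofReal_mul, Complex.add_re, e1, e2, Complex.mul_re]
    norm_num
    have : 0 ≤ C * (‖y‖ - ‖z‖) ^ 2 := by positivity
    nlinarith
  rw [hM] at hpos
  simp only [map_add, map_smul, map_sum, ← hΦ] at hpos
  rw [inner_matrixOp, PiLp.norm_sq_eq_of_L2, PiLp.norm_sq_eq_of_L2]
  have h1 : ∑ l, (inner ℂ (v l) (Φ 1 (v l))).re ≤ ∑ l, ‖v l‖ ^ 2 :=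
    Finset.sum_le_sum fun l _ => hone _
  have h2 : ∑ l, (inner ℂ (w l) (Φ 1 (w l))).re ≤ ∑ l, ‖w l‖ ^ 2 :=
    Finset.sum_le_sum fun l _ => hone _
  have h3 := mul_le_mul_of_nonneg_left (add_le_add h1 h2) hC
  simp only [smul_eq_mul, Complex.add_re, Complex.re_sum, Complex.mul_re, Complex.ofReal_re,
    Complex.ofReal_im,    Complex.re_ofNat, Complex.im_ofNat, zero_mul, sub_zero] at hpos
  simp only [Matrix.map_apply, Complex.re_sum]
  linarith

/-- Arveson's extension theorem: a unital completely contractive map from a space of operators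
on `K` into the bounded operators on `H` extends to all bounded operators on `K`. -/
theorem exists_arveson_extension [CompleteSpace H] {W : Type u} [AddCommGroup W] [Module ℂ W]
    (r : W →ₗ[ℂ] (K →L[ℂ] K)) (f : W →ₗ[ℂ] (H →L[ℂ] H)) (u : W) (hr : r u = 1) (hf : f u = 1)
    (h : ∀ (n : ℕ) (a : Matrix (Fin n) (Fin n) W), ‖matrixOp (a.map f)‖ ≤ ‖matrixOp (a.map r)‖) :
    ∃ Φ : (K →L[ℂ] K) →ₗ[ℂ] (H →L[ℂ] H),
      (∀ (m : ℕ) (a : Matrix (Fin m) (Fin m) (K →L[ℂ] K)),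
        ‖matrixOp (a.map Φ)‖ ≤ ‖matrixOp a‖) ∧ ∀ z, Φ (r z) = f z := by
  classical
  have hP : ∀ F : Finset H, ∃ Φ : (K →L[ℂ] K) →ₗ[ℂ] (H →L[ℂ] H),
      (∀ (m : ℕ) (a : Matrix (Fin m) (Fin m) (K →L[ℂ] K)),
        ‖matrixOp (a.map Φ)‖ ≤ ‖matrixOp a‖) ∧
      ∀ z, ∀ v ∈ F, ∀ w ∈ F, inner ℂ w (Φ (r z) v) = inner ℂ w (f z v) := by
    intro F
    let V := Submodule.span ℂ (F : Set H)
    let b := stdOrthonormalBasis ℂ V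
    have hb : ∀ v ∈ F, ∑ i, (inner ℂ (b i : H) v : ℂ) • (b i : H) = v := fun v hv => by
      have := congrArg Subtype.val (b.sum_repr' ⟨v, Submodule.subset_span hv⟩)
      simpa using this
    obtain ⟨Φ, hΦ, hΦ'⟩ := exists_finite_arveson r f u hr hf h (fun i => (b i : H))
      (b.orthonormal.comp_linearIsometry V.subtypeₗᵢ)
    exact ⟨Φ, hΦ, fun z v hv w hw => by rw [hΦ', hb v hv, hb w hw]⟩
  choose Ψ hΨ hΨ' using hP
  -- Finer than `atTop`, so any given pair of vectors eventually lies in F.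
  let U : Ultrafilter (Finset H) := Ultrafilter.of Filter.atTop
  have hU : (U : Filter (Finset H)) ≤ Filter.atTop := Ultrafilter.of_le _
  obtain ⟨Φ, hΦ⟩ := exists_weak_limit U Ψ (fun a => ‖a‖) fun F a => by
    have := hΨ F 1 (fun _ _ => a)
    rw [norm_matrixOp_one_by_one] at this
    exact (norm_matrixOp_one_by_one _).symm.trans_le this
  refine ⟨Φ, fun m a => norm_matrixOp_le_of_tendsto hΦ (.of_forall fun F => hΨ F m a), fun z => ?_⟩
  ext v
  refine ext_inner_left ℂ fun w => tendsto_nhds_unique (hΦ _ _ _) ?_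
  refine tendsto_const_nhds.congr' (hU ?_)
  filter_upwards [Filter.eventually_ge_atTop {v, w}] with F hF
  exact (hΨ' F z v (hF (by simp)) w (hF (by simp))).symm

end Arveson

/-! ### Ucc maps, injectivity, and kernels as boundary subsystems. -/

section Maps

variable {E F G : Type u} [AddCommGroup E] [Module ℂ E] [AddCommGroup F] [Module ℂ F]
  [AddCommGroup G] [Module ℂ G]
  {𝓔 : UnitalOperatorSpace E} {𝓕 : UnitalOperatorSpace F} {𝓖 : UnitalOperatorSpace G}

theorem UnitalOperatorSpace.matNorm_zero (n : ℕ) : 𝓔.matNorm n 0 = 0 := by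
  obtain ⟨K, _, _, _, r, -, -, hn⟩ := 𝓔.exists_rep
  rw [← hn, Matrix.map_zero _ (map_zero r), ← matrixOpₗ_apply, map_zero, norm_zero]

theorem UnitalOperatorSpace.eq_zero_of_matNorm_le {x : E}
    (h : 𝓔.matNorm 1 (fun _ _ => x) ≤ 0) : x = 0 := by
  obtain ⟨K, _, _, _, r, hi, -, hn⟩ := 𝓔.exists_rep
  have h1 : ‖r x‖ ≤ 0 := (norm_matrixOp_one_by_one (r x)).symm.trans_le
    ((hn 1 fun _ _ => x).trans_le h)
  exact hi (by rw [map_zero, ← norm_le_zero_iff]; exact h1)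

theorem IsUCC.comp {ψ : F →ₗ[ℂ] G} {φ : E →ₗ[ℂ] F} (hψ : IsUCC 𝓕 𝓖 ψ) (hφ : IsUCC 𝓔 𝓕 φ) :
    IsUCC 𝓔 𝓖 (ψ ∘ₗ φ) :=
  ⟨by rw [LinearMap.comp_apply, hφ.1, hψ.1],
    fun n a => (hψ.2 n (a.map φ)).trans (hφ.2 n a)⟩

theorem IsUCIS.isUCC {φ : E →ₗ[ℂ] F} (hφ : IsUCIS 𝓔 𝓕 φ) : IsUCC 𝓔 𝓕 φ :=
  ⟨hφ.1, fun n a => (hφ.2 n a).le⟩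

theorem isUCC_id : IsUCC 𝓔 𝓔 LinearMap.id := ⟨rfl, fun _ _ => le_rfl⟩

theorem isUCC_subtype (V : Submodule ℂ E) (hV : 𝓔.unit ∈ V) :
    IsUCC (𝓔.restrict V hV) 𝓔 V.subtype := ⟨rfl, fun _ _ => le_rfl⟩

theorem IsUCC.codRestrict {φ : E →ₗ[ℂ] F} (hφ : IsUCC 𝓔 𝓕 φ) (V : Submodule ℂ F)
    (hV : 𝓕.unit ∈ V) (h : ∀ x, φ x ∈ V) :
    IsUCC 𝓔 (𝓕.restrict V hV) (φ.codRestrict V h) :=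
  ⟨Subtype.ext hφ.1, fun n a => hφ.2 n a⟩

/-- Extension along a linear map that need not be an inclusion. -/
theorem UnitalOperatorSpace.IsInjective.exists_extension_along (h𝓔 : 𝓔.IsInjective)
    {W : Type*} [AddCommGroup W] [Module ℂ W] (T : W →ₗ[ℂ] F) (g : W →ₗ[ℂ] E) (w₀ : W)
    (hT : T w₀ = 𝓕.unit) (hg : g w₀ = 𝓔.unit)
    (h : ∀ (n : ℕ) (a : Matrix (Fin n) (Fin n) W),
      𝓔.matNorm n (a.map g) ≤ 𝓕.matNorm n (a.map T)) :
    ∃ ψ : F →ₗ[ℂ] E, IsUCC 𝓕 𝓔 ψ ∧ ∀ w, ψ (T w) = g w := by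
  obtain ⟨p, hp⟩ := T.rangeRestrict.exists_rightInverse_of_surjective T.range_rangeRestrict
  have hp' : ∀ y, T (p y) = y := fun y => congrArg Subtype.val (LinearMap.congr_fun hp y)
  have hpT : ∀ w, g (p ⟨T w, w, rfl⟩) = g w := by
    intro w
    rw [← sub_eq_zero, ← map_sub]
    refine 𝓔.eq_zero_of_matNorm_le ((h 1 fun _ _ => p ⟨T w, w, rfl⟩ - w).trans_eq ?_)
    rw [← 𝓕.matNorm_zero 1]
    congr 1
    ext i j
    exact (map_sub T _ _).trans (sub_eq_zero.2 (hp' _))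
  have hgp : IsUCC (𝓕.restrict (LinearMap.range T) ⟨w₀, hT⟩) 𝓔 (g ∘ₗ p) := by
    refine ⟨?_, fun n a => (h n (a.map p)).trans_eq ?_⟩
    · have := hpT w₀
      simp only [hT] at this
      exact this.trans hg
    · change 𝓕.matNorm n _ = 𝓕.matNorm n _
      congr 1
      ext i j
      exact hp' _
  obtain ⟨ψ, hψ, hψ'⟩ := h𝓔 F 𝓕 (LinearMap.range T) ⟨w₀, hT⟩ (g ∘ₗ p) hgp
  exact ⟨ψ, hψ, fun w => (hψ' ⟨T w, w, rfl⟩).trans (hpT w)⟩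

/-- Retracts of injective unital operator spaces are injective. -/
theorem UnitalOperatorSpace.IsInjective.of_retract (h𝓔 : 𝓔.IsInjective) {i : F →ₗ[ℂ] E}
    {p : E →ₗ[ℂ] F} (hi : IsUCC 𝓕 𝓔 i) (hp : IsUCC 𝓔 𝓕 p) (h : ∀ x, p (i x) = x) :
    𝓕.IsInjective := by
  intro Y _ _ 𝓨 Z hZ φ hφ
  obtain ⟨ψ, hψ, hψ'⟩ := h𝓔 Y 𝓨 Z hZ (i ∘ₗ φ) (hi.comp hφ)
  exact ⟨p ∘ₗ ψ, hp.comp hψ, fun z => by rw [LinearMap.comp_apply, hψ', LinearMap.comp_apply, h]⟩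

variable {H : Type u} [NormedAddCommGroup H] [InnerProductSpace ℂ H] [CompleteSpace H]

theorem isInjective_boundedOperators : (boundedOperators H).IsInjective := by
  intro Y _ _ 𝓨 Z hZ φ hφ
  obtain ⟨K, _, _, _, r, -, hr, hn⟩ := 𝓨.exists_rep
  obtain ⟨Φ, hΦ, hΦ'⟩ := exists_arveson_extension (r ∘ₗ Z.subtype) φ ⟨𝓨.unit, hZ⟩ hr hφ.1
    fun n a => (hφ.2 n a).trans_eq (hn n (a.map Subtype.val)).symm
  refine ⟨Φ ∘ₗ r, ⟨?_, fun n a => ?_⟩, hΦ'⟩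
  · exact (hΦ' ⟨𝓨.unit, hZ⟩).trans hφ.1
  · exact (hΦ n (a.map r)).trans_eq (hn n a)

theorem IsUCC.norm_le {L : Type u} [NormedAddCommGroup L] [InnerProductSpace ℂ L]
    [CompleteSpace L] {φ : (H →L[ℂ] H) →ₗ[ℂ] (L →L[ℂ] L)}
    (hφ : IsUCC (boundedOperators H) (boundedOperators L) φ) (a : H →L[ℂ] H) : ‖φ a‖ ≤ ‖a‖ := by
  have := hφ.2 1 fun _ _ => a
  exact (norm_matrixOp_one_by_one (φ a)).symm.trans_le
    (this.trans_eq (norm_matrixOp_one_by_one a))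

/-- The target has no involution, so a representation is composed first: a unital contraction into
B(K) preserves adjoints, and the representation is injective. -/
theorem IsUCC.star_mem_ker {φ : (H →L[ℂ] H) →ₗ[ℂ] E} (hφ : IsUCC (boundedOperators H) 𝓔 φ)
    {a : H →L[ℂ] H} (ha : a ∈ LinearMap.ker φ) : star a ∈ LinearMap.ker φ := by
  obtain ⟨K, _, _, _, r, hi, hr, hn⟩ := 𝓔.exists_rep
  have hrφ : IsUCC (boundedOperators H) (boundedOperators K) (r ∘ₗ φ) :=
    ⟨(congrArg r hφ.1).trans hr, fun n b => (hn n (b.map φ)).trans_le (hφ.2 n b)⟩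
  have := map_star_of_unital_contraction (r ∘ₗ φ) hrφ.1 hrφ.norm_le a
  rw [LinearMap.comp_apply, LinearMap.comp_apply, LinearMap.mem_ker.1 ha, map_zero, star_zero] at this
  exact hi (this.trans (map_zero r).symm)

variable {X : Submodule ℂ (H →L[ℂ] H)} {hX : (1 : H →L[ℂ] H) ∈ X} {ι : X →ₗ[ℂ] E}

theorem quotientMatNorm_le (I : Submodule ℂ (H →L[ℂ] H)) {n : ℕ}
    (a : Matrix (Fin n) (Fin n) (H →L[ℂ] H)) (y : Matrix (Fin n) (Fin n) I) :
    quotientMatNorm I a ≤ ‖matrixOp (a + y.map (fun v : I => (v : H →L[ℂ] H)))‖ :=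
  ciInf_le ⟨0, by rintro _ ⟨y, rfl⟩; exact norm_nonneg (matrixOp _)⟩ y

/-- Adding kernel elements y does not change the image, so ‖x + y‖ ≥ ‖φ(x + y)‖ = ‖ι(x)‖ = ‖x‖ at
each matrix level. -/
theorem isBoundarySubsystem_ker (hι : IsUCIS ((boundedOperators H).restrict X hX) 𝓔 ι)
    {φ : (H →L[ℂ] H) →ₗ[ℂ] E} (hφ : IsUCC (boundedOperators H) 𝓔 φ) (h : ∀ x : X, φ x = ι x) :
    IsBoundarySubsystem X (LinearMap.ker φ) := by
  refine ⟨fun a ha => hφ.star_mem_ker ha, fun n x hx => le_antisymm ?_ (le_ciInf fun y => ?_)⟩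
  · refine (quotientMatNorm_le _ x 0).trans_eq ?_
    rw [Matrix.map_zero _ rfl, add_zero]
  · let x' : Matrix (Fin n) (Fin n) X := fun i j => ⟨x i j, hx i j⟩
    have h1 : (x + y.map fun v : LinearMap.ker φ => (v : H →L[ℂ] H)).map φ = x'.map ι := by
      ext i j
      have h2 : φ (y i j) = 0 := (y i j).2
      simp only [Matrix.map_apply, Matrix.add_apply, map_add, h2, add_zero]
      exact h (x' i j)
    have h2 := hφ.2 n (x + y.map fun v : LinearMap.ker φ => (v : H →L[ℂ] H))
    rw [h1, hι.2] at h2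
    exact h2

theorem IsBoundarySubsystem.exists_le_ker {I : Submodule ℂ (H →L[ℂ] H)}
    (hI : IsBoundarySubsystem X I) (h𝓔 : 𝓔.IsInjective)
    (hι : IsUCIS ((boundedOperators H).restrict X hX) 𝓔 ι) :
    ∃ φ : (H →L[ℂ] H) →ₗ[ℂ] E, IsUCC (boundedOperators H) 𝓔 φ ∧ (∀ x : X, φ x = ι x) ∧
      I ≤ LinearMap.ker φ := by
  obtain ⟨φ, hφ, h⟩ := h𝓔.exists_extension_along (𝓕 := boundedOperators H)
    -- Working on X × I instead of X + I leaves well-definedness to the norm estimate.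
    (X.subtype.coprod I.subtype) (ι ∘ₗ LinearMap.fst ℂ X I) (⟨1, hX⟩, 0) (by simp; rfl) hι.1
    fun n a => by
      refine (hι.2 n (a.map Prod.fst)).trans_le ?_
      refine (hI.2 n _ fun i j => (a i j).1.2).symm.trans_le ?_
      exact quotientMatNorm_le I _ (a.map Prod.snd)
  refine ⟨φ, hφ, fun x => ?_, fun y hy => ?_⟩
  · simpa using h (x, 0)
  · simpa using h (0, ⟨y, hy⟩)

end Maps

/-! ### Minimal maps and rigidity of injective envelopes. -/

section InjectiveEnvelope

variable {H : Type u} [NormedAddCommGroup H] [InnerProductSpace ℂ H] [CompleteSpace H]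
  {X : Submodule ℂ (H →L[ℂ] H)}

/-- The unital completely contractive maps on `B(H)` that fix every element of `X`. -/
def uccFixing (X : Submodule ℂ (H →L[ℂ] H)) : Set ((H →L[ℂ] H) →ₗ[ℂ] (H →L[ℂ] H)) :=
  {φ | IsUCC (boundedOperators H) (boundedOperators H) φ ∧ ∀ x ∈ X, φ x = x}

/-- A map in `uccFixing X` whose seminorm `b ↦ ‖φ b‖` is minimal. -/
def IsMinimalFixing (X : Submodule ℂ (H →L[ℂ] H)) (φ : (H →L[ℂ] H) →ₗ[ℂ] (H →L[ℂ] H)) : Prop :=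
  φ ∈ uccFixing X ∧ ∀ ψ ∈ uccFixing X, (∀ b, ‖ψ b‖ ≤ ‖φ b‖) → ∀ b, ‖φ b‖ ≤ ‖ψ b‖

theorem id_mem_uccFixing : LinearMap.id ∈ uccFixing X := ⟨isUCC_id, fun _ _ => rfl⟩

theorem comp_mem_uccFixing {φ ψ : (H →L[ℂ] H) →ₗ[ℂ] (H →L[ℂ] H)} (hφ : φ ∈ uccFixing X)
    (hψ : ψ ∈ uccFixing X) : φ ∘ₗ ψ ∈ uccFixing X :=
  ⟨hφ.1.comp hψ.1, fun x hx => by rw [LinearMap.comp_apply, hψ.2 x hx, hφ.2 x hx]⟩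

theorem pow_mem_uccFixing {φ : (H →L[ℂ] H) →ₗ[ℂ] (H →L[ℂ] H)} (hφ : φ ∈ uccFixing X) (k : ℕ) :
    φ ^ k ∈ uccFixing X := by
  induction k with
  | zero => exact id_mem_uccFixing
  | succ k ih => rw [pow_succ]; exact comp_mem_uccFixing ih hφ

theorem average_mem_uccFixing (hX : (1 : H →L[ℂ] H) ∈ X)
    {f : ℕ → (H →L[ℂ] H) →ₗ[ℂ] (H →L[ℂ] H)} (hf : ∀ k, f k ∈ uccFixing X) {n : ℕ} (hn : n ≠ 0) :
    (n : ℂ)⁻¹ • ∑ k ∈ Finset.range n, f k ∈ uccFixing X := by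
  have hn' : (n : ℂ) ≠ 0 := Nat.cast_ne_zero.2 hn
  have hfix : ∀ x ∈ X, ((n : ℂ)⁻¹ • ∑ k ∈ Finset.range n, f k) x = x := fun x hx => by
    rw [LinearMap.smul_apply, LinearMap.sum_apply, Finset.sum_congr rfl fun k _ => (hf k).2 x hx,
      Finset.sum_const, Finset.card_range, ← Nat.cast_smul_eq_nsmul ℂ, inv_smul_smul₀ hn']
  refine ⟨⟨hfix 1 hX, fun m a => ?_⟩, hfix⟩
  have e : matrixOp (a.map ((n : ℂ)⁻¹ • ∑ k ∈ Finset.range n, f k)) =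
      (n : ℂ)⁻¹ • ∑ k ∈ Finset.range n, matrixOp (a.map (f k)) := by
    simp only [← matrixOpₗ_apply, ← map_sum, ← map_smul]
    congr 1
    ext1 i j
    rw [Matrix.smul_apply, Matrix.sum_apply, Matrix.map_apply, LinearMap.smul_apply,
      LinearMap.sum_apply]
    rfl
  change ‖matrixOp (a.map ((n : ℂ)⁻¹ • ∑ k ∈ Finset.range n, f k))‖ ≤ ‖matrixOp a‖
  rw [e, norm_smul, norm_inv, Complex.norm_natCast, inv_mul_le_iff₀ (by positivity)]
  refine (norm_sum_le_of_le _ fun k _ => (hf k).1.2 m a).trans_eq ?_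
  rw [Finset.sum_const, Finset.card_range, nsmul_eq_mul]
  rfl

/-- Zorn's lemma: a weak limit along the tails of a chain lies below the whole chain, since norm
bounds survive weak limits. -/
theorem exists_isMinimalFixing (X : Submodule ℂ (H →L[ℂ] H)) : ∃ φ, IsMinimalFixing X φ := by
  let R : uccFixing X → uccFixing X → Prop := fun φ ψ => ∀ b, ‖ψ.1 b‖ ≤ ‖φ.1 b‖
  suffices h : ∀ c, IsChain R c → ∃ ub, ∀ a ∈ c, R a ub by
    obtain ⟨m, hm⟩ := exists_maximal_of_chains_bounded h fun h₁ h₂ b => (h₂ b).trans (h₁ b)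
    exact ⟨m.1, m.2, fun ψ hψ h => hm ⟨ψ, hψ⟩ h⟩
  intro c hc
  rcases c.eq_empty_or_nonempty with rfl | ⟨φ₀, hφ₀⟩
  · exact ⟨⟨_, id_mem_uccFixing⟩, by simp⟩
  have hrefl : ∀ φ, R φ φ := fun φ b => le_rfl
  have : Std.Refl R := ⟨hrefl⟩
  let 𝓕 : Filter (uccFixing X) := ⨅ φ : c, Filter.principal {ψ | R φ ψ}
  have : Nonempty c := ⟨⟨φ₀, hφ₀⟩⟩
  have : 𝓕.NeBot := by
    refine Filter.iInf_neBot_of_directed' ?_ fun φ =>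
      Filter.principal_neBot_iff.2 ⟨φ, hrefl φ⟩
    intro φ ψ
    rcases hc.total φ.2 ψ.2 with h | h
    · exact ⟨ψ, Filter.principal_mono.2 fun θ hθ b => (hθ b).trans (h b), le_rfl⟩
    · exact ⟨φ, le_rfl, Filter.principal_mono.2 fun θ hθ b => (hθ b).trans (h b)⟩
  let U := Ultrafilter.of 𝓕
  obtain ⟨g, hg⟩ := exists_weak_limit U (fun φ : uccFixing X => φ.1) (fun a => ‖a‖)
    fun φ a => φ.2.1.norm_le a
  have hUF : (U : Filter (uccFixing X)) ≤ 𝓕 := Ultrafilter.of_le 𝓕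
  have hev : ∀ φ ∈ c, ∀ᶠ ψ in (U : Filter (uccFixing X)), R φ ψ := fun φ hφ => by
    have h1 : 𝓕 ≤ Filter.principal {ψ | R φ ψ} :=
      iInf_le (fun φ : c => Filter.principal {ψ | R φ ψ}) ⟨φ, hφ⟩
    exact Filter.le_principal_iff.1 (hUF.trans h1)
  have hfix : ∀ a, (∀ φ : uccFixing X, φ.1 a = a) → g a = a := fun a ha => by
    ext v
    refine ext_inner_left ℂ fun w => tendsto_nhds_unique (hg a v w) ?_
    simp only [ha]
    exact tendsto_const_nhds
  have hgn : ∀ (n : ℕ) (a : Matrix (Fin n) (Fin n) (H →L[ℂ] H)),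
      ‖matrixOp (a.map g)‖ ≤ ‖matrixOp a‖ := fun n a =>
    norm_matrixOp_le_of_tendsto hg (.of_forall fun φ => φ.2.1.2 n a)
  have hg1 : g 1 = 1 := hfix 1 fun φ => φ.2.1.1
  have hgX : g ∈ uccFixing X := ⟨⟨hg1, hgn⟩, fun x hx => hfix x fun φ => φ.2.2 x hx⟩
  refine ⟨⟨g, hgX⟩, fun φ hφ b => ?_⟩
  have hb : ‖matrixOp (Matrix.map (fun _ _ : Fin 1 => b) g)‖ ≤ ‖φ.1 b‖ := by
    refine norm_matrixOp_le_of_tendsto hg ?_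
    filter_upwards [hev φ hφ] with ψ hψ
    exact (norm_matrixOp_one_by_one (ψ.1 b)).trans_le (hψ b)
  exact (norm_matrixOp_one_by_one (g b)).symm.trans_le hb

theorem IsMinimalFixing.comp {φ θ : (H →L[ℂ] H) →ₗ[ℂ] (H →L[ℂ] H)} (hφ : IsMinimalFixing X φ)
    (hθ : θ ∈ uccFixing X) : IsMinimalFixing X (θ ∘ₗ φ) := by
  have hle : ∀ b, ‖(θ ∘ₗ φ) b‖ ≤ ‖φ b‖ := fun b => hθ.1.norm_le _
  exact ⟨comp_mem_uccFixing hθ hφ.1, fun ψ hψ h b =>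
    (hle b).trans (hφ.2 ψ hψ (fun b => (h b).trans (hle b)) b)⟩

/-- By minimality, averaging the powers φ, …, φⁿ cannot shrink the seminorm. At b - φ(b) the average
telescopes and is at most 2‖b‖/n, so φ(b - φ(b)) = 0. -/
theorem IsMinimalFixing.idempotent (hX : (1 : H →L[ℂ] H) ∈ X)
    {φ : (H →L[ℂ] H) →ₗ[ℂ] (H →L[ℂ] H)} (hφ : IsMinimalFixing X φ) (b : H →L[ℂ] H) :
    φ (φ b) = φ b := by
  have key : ∀ n : ℕ, n ≠ 0 → n * ‖φ (b - φ b)‖ ≤ 2 * ‖b‖ := by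
    intro n hn
    let ψ := ((n : ℂ)⁻¹ • ∑ k ∈ Finset.range n, φ ^ k) ∘ₗ φ
    have hψ : ψ = ((n : ℂ)⁻¹ • ∑ k ∈ Finset.range n, φ ^ k) ∘ₗ φ := rfl
    have hA := average_mem_uccFixing hX (fun k => pow_mem_uccFixing hφ.1 k) hn
    have h1 := hφ.2 ψ (comp_mem_uccFixing hA hφ.1) (fun c => hA.1.norm_le _) (b - φ b)
    have h2 : ∀ m : ℕ, (∑ k ∈ Finset.range m, φ ^ k) (φ (b - φ b)) = φ b - (φ ^ m) (φ b) := by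
      intro m
      induction m with
      | zero => simp
      | succ m ih =>
        rw [Finset.sum_range_succ, LinearMap.add_apply, ih, pow_succ, Module.End.mul_apply]
        simp
    rw [hψ, LinearMap.comp_apply, LinearMap.smul_apply, h2, norm_smul, norm_inv,
      Complex.norm_natCast, le_inv_mul_iff₀ (by positivity)] at h1
    have h3 := hφ.1.1.norm_le b
    have h4 := (pow_mem_uccFixing hφ.1 n).1.norm_le (φ b)
    have h5 := norm_sub_le (φ b) ((φ ^ n) (φ b))
    linarith
  have h0 : ‖φ (b - φ b)‖ ≤ 0 := by
    by_contra! hpos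
    obtain ⟨n, hn⟩ := exists_nat_gt (2 * ‖b‖ / ‖φ (b - φ b)‖)
    rw [div_lt_iff₀ hpos] at hn
    have hn0 : n ≠ 0 := by
      rintro rfl
      have := norm_nonneg b
      simp at hn
      linarith
    exact (key n hn0).not_gt hn
  rw [norm_le_zero_iff, map_sub, sub_eq_zero] at h0
  exact h0.symm

/-- A unital completely contractive self-map of the range of a minimal map that fixes `X` is the
identity. -/
theorem IsMinimalFixing.rigid (hX : (1 : H →L[ℂ] H) ∈ X)
    {φ : (H →L[ℂ] H) →ₗ[ℂ] (H →L[ℂ] H)} (hφ : IsMinimalFixing X φ)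
    {u : LinearMap.range φ →ₗ[ℂ] LinearMap.range φ} {h1 : (1 : H →L[ℂ] H) ∈ LinearMap.range φ}
    (hu : IsUCC ((boundedOperators H).restrict (LinearMap.range φ) h1)
      ((boundedOperators H).restrict (LinearMap.range φ) h1) u)
    (hfix : ∀ x : LinearMap.range φ, (x : H →L[ℂ] H) ∈ X → u x = x) (s : LinearMap.range φ) :
    u s = s := by
  have hφs : ∀ s : LinearMap.range φ, φ s = s := by
    rintro ⟨_, b, rfl⟩
    exact hφ.idempotent hX b
  let θ : (H →L[ℂ] H) →ₗ[ℂ] (H →L[ℂ] H) := (LinearMap.range φ).subtype ∘ₗ u ∘ₗ φ.rangeRestrict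
  have hθs : ∀ s : LinearMap.range φ, θ s = u s := fun s => by
    change ((u (φ.rangeRestrict s) : LinearMap.range φ) : H →L[ℂ] H) = _
    congr 2
    exact Subtype.ext (hφs s)
  have hθ : θ ∈ uccFixing X := by
    refine ⟨(isUCC_subtype _ h1).comp (hu.comp (hφ.1.1.codRestrict _ h1 _)), fun x hx => ?_⟩
    have hx' := hφ.1.2 x hx
    have := hfix ⟨x, x, hx'⟩ hx
    exact (hθs ⟨x, x, hx'⟩).trans (congrArg Subtype.val this)
  have hθφ := hφ.comp hθ
  -- θ ∘ φ is minimal too, hence idempotent; on the range of φ this says u² = u.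
  have hid : θ (θ s) = θ s := by
    have := hθφ.idempotent hX s
    simp only [LinearMap.comp_apply, hφs] at this
    rwa [hθs s, hφs, ← hθs s] at this
  -- Minimality of φ against θ ∘ φ at u(s) - s, which u annihilates.
  have h2 := hφ.2 _ hθφ.1 (fun b => hθ.1.norm_le _) ((u s : H →L[ℂ] H) - s)
  rw [LinearMap.comp_apply, map_sub φ, hφs, hφs, map_sub, ← hθs s, hid, sub_self, norm_zero,
    norm_le_zero_iff, sub_eq_zero, hθs] at h2
  exact Subtype.ext h2

/-- `S` has no unital completely contractive self-map over `ι` other than the identity. -/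
def IsRigid {X S : Type u} [AddCommGroup X] [Module ℂ X] [AddCommGroup S] [Module ℂ S]
    (𝓢 : UnitalOperatorSpace S) (ι : X →ₗ[ℂ] S) : Prop :=
  ∀ u : S →ₗ[ℂ] S, IsUCC 𝓢 𝓢 u → (∀ x, u (ι x) = ι x) → ∀ s, u s = s

/-- An injective V containing ι(X) admits a ucc projection S → V; rigidity makes it the identity of
S. -/
theorem IsRigid.isInjectiveEnvelope {X S : Type u} [AddCommGroup X] [Module ℂ X] [AddCommGroup S]
    [Module ℂ S] {𝓧 : UnitalOperatorSpace X} {𝓢 : UnitalOperatorSpace S} {ι : X →ₗ[ℂ] S}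
    (h : IsRigid 𝓢 ι) (hι : IsUCIS 𝓧 𝓢 ι) (h𝓢 : 𝓢.IsInjective) :
    IsInjectiveEnvelope 𝓧 𝓢 ι := by
  refine ⟨hι, h𝓢, fun V hV hιV hinj => ?_⟩
  obtain ⟨ψ, hψ, hψ'⟩ := hinj S 𝓢 V hV LinearMap.id isUCC_id
  have := h (V.subtype ∘ₗ ψ) ((isUCC_subtype V hV).comp hψ) fun x =>
    congrArg Subtype.val (hψ' ⟨ι x, hιV ⟨x, rfl⟩⟩)
  exact eq_top_iff.2 fun s _ => by
    rw [← this s]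
    exact (ψ s).2

/-- Every unital subspace of `B(H)` has a rigid injective envelope. -/
theorem exists_rigid_isInjectiveEnvelope (X : Submodule ℂ (H →L[ℂ] H))
    (hX : (1 : H →L[ℂ] H) ∈ X) :
    ∃ (S : Type u) (_ : AddCommGroup S) (_ : Module ℂ S) (𝓢 : UnitalOperatorSpace S)
      (ι : X →ₗ[ℂ] S), IsInjectiveEnvelope ((boundedOperators H).restrict X hX) 𝓢 ι ∧
        IsRigid 𝓢 ι := by
  obtain ⟨φ, hφ⟩ := exists_isMinimalFixing X
  have h1 : (1 : H →L[ℂ] H) ∈ LinearMap.range φ := ⟨1, hφ.1.1.1⟩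
  let ι : X →ₗ[ℂ] LinearMap.range φ :=
    X.subtype.codRestrict _ fun x => ⟨x, hφ.1.2 x x.2⟩
  have hr : IsRigid ((boundedOperators H).restrict (LinearMap.range φ) h1) ι :=
    fun u hu hfix s => hφ.rigid hX hu (fun x hx => hfix ⟨x, hx⟩) s
  refine ⟨LinearMap.range φ, inferInstance, inferInstance, _, ι,
    hr.isInjectiveEnvelope ⟨rfl, fun _ _ => rfl⟩ ?_, hr⟩
  refine isInjective_boundedOperators.of_retract (isUCC_subtype _ h1)
    (hφ.1.1.codRestrict _ h1 fun b => ⟨b, rfl⟩) ?_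
  rintro ⟨_, b, rfl⟩
  exact Subtype.ext (hφ.idempotent hX b)

/-- Every injective envelope is rigid, as soon as one of them is. -/
theorem IsInjectiveEnvelope.isRigid {X S T : Type u} [AddCommGroup X] [Module ℂ X]
    [AddCommGroup S] [Module ℂ S] [AddCommGroup T] [Module ℂ T] {𝓧 : UnitalOperatorSpace X}
    {𝓢 : UnitalOperatorSpace S} {𝓣 : UnitalOperatorSpace T} {ι : X →ₗ[ℂ] S} {κ : X →ₗ[ℂ] T}
    (hS : IsInjectiveEnvelope 𝓧 𝓢 ι) (hT : IsInjectiveEnvelope 𝓧 𝓣 κ) (hr : IsRigid 𝓣 κ) :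
    IsRigid 𝓢 ι := by
  obtain ⟨α, hα, hακ⟩ := hS.2.1.exists_extension_along (𝓕 := 𝓣) κ ι 𝓧.unit hT.1.1 hS.1.1
    fun n a => ((hS.1.2 n a).trans (hT.1.2 n a).symm).le
  obtain ⟨β, hβ, hβι⟩ := hT.2.1.exists_extension_along (𝓕 := 𝓢) ι κ 𝓧.unit hS.1.1 hT.1.1
    fun n a => ((hT.1.2 n a).trans (hS.1.2 n a).symm).le
  have hβα := hr _ (hβ.comp hα) fun x => by rw [LinearMap.comp_apply, hακ, hβι]
  have hV : 𝓢.unit ∈ LinearMap.range α := ⟨𝓣.unit, hα.1⟩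
  -- The range of α is a retract of T, hence injective, so the minimality of S applies.
  have htop : LinearMap.range α = ⊤ := by
    refine hS.2.2 _ hV ?_ (hT.2.1.of_retract (hβ.comp (isUCC_subtype _ hV))
      (hα.codRestrict _ hV fun t => ⟨t, rfl⟩) ?_)
    · rintro _ ⟨x, rfl⟩
      exact ⟨κ x, hακ x⟩
    · rintro ⟨_, t, rfl⟩
      exact Subtype.ext (congrArg α (hβα t))
  have hαβ : ∀ s, α (β s) = s := fun s => by
    obtain ⟨t, rfl⟩ := LinearMap.range_eq_top.1 htop s
    exact congrArg α (hβα t)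
  intro u hu hfix s
  -- Rigidity of T is applied to the conjugate β ∘ u ∘ α.
  have := hr _ (hβ.comp (hu.comp hα)) (fun x => by
    simp only [LinearMap.comp_apply, hακ, hfix, hβι]) (β s)
  simp only [LinearMap.comp_apply, hαβ] at this
  rw [← hαβ (u s), this, hαβ]

end InjectiveEnvelope

/-! ### Maximal boundary subsystems are the kernels. -/

theorem mainTheorem7 {H : Type u} [NormedAddCommGroup H] [InnerProductSpace ℂ H]
    [CompleteSpace H] (X : Submodule ℂ (H →L[ℂ] H)) (hX : (1 : H →L[ℂ] H) ∈ X)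
    (I : Submodule ℂ (H →L[ℂ] H)) :
    Maximal (IsBoundarySubsystem X) I ↔
      ∃ (S : Type u) (_ : AddCommGroup S) (_ : Module ℂ S) (𝓢 : UnitalOperatorSpace S)
        (ι : X →ₗ[ℂ] S) (φ : (H →L[ℂ] H) →ₗ[ℂ] S),
        IsInjectiveEnvelope ((boundedOperators H).restrict X hX) 𝓢 ι ∧
          IsUCC (boundedOperators H) 𝓢 φ ∧ (∀ x : X, φ x = ι x) ∧ I = LinearMap.ker φ := by
  obtain ⟨T, _, _, 𝓣, κ, hT, hr⟩ := exists_rigid_isInjectiveEnvelope X hX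
  constructor
  · intro hI
    obtain ⟨φ, hφ, hφκ, hle⟩ := hI.prop.exists_le_ker hT.2.1 hT.1
    exact ⟨T, _, _, 𝓣, κ, φ, hT, hφ, hφκ,
      hle.antisymm (hI.2 (isBoundarySubsystem_ker hT.1 hφ hφκ) hle)⟩
  · rintro ⟨S, _, _, 𝓢, ι, φ, hS, hφ, hφι, rfl⟩
    refine ⟨isBoundarySubsystem_ker hS.1 hφ hφι, fun J hJ hle => ?_⟩
    obtain ⟨ψ, hψ, hψι, hJψ⟩ := hJ.exists_le_ker hS.2.1 hS.1
    obtain ⟨θ, hθ, hθι⟩ := isInjective_boundedOperators.exists_extension_along (𝓕 := 𝓢) ι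
      X.subtype ⟨1, hX⟩ hS.1.1 rfl fun n a => (hS.1.2 n a).ge
    have hrS := hS.isRigid hT hr
    have hφθ := hrS _ (hφ.comp hθ) fun x => by
      rw [LinearMap.comp_apply, hθι]; exact hφι x
    have hψθ := hrS _ (hψ.comp hθ) fun x => by
      rw [LinearMap.comp_apply, hθι]; exact hψι x
    intro b hb
    -- This element links the maps: ψ kills ker φ, so ψ(b) = ψ(θ(φ(b))) = φ(b).
    have h1 : b - θ (φ b) ∈ LinearMap.ker φ := by
      rw [LinearMap.mem_ker, map_sub, sub_eq_zero]
      exact (hφθ (φ b)).symm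
    have h2 : ψ b = 0 := hJψ hb
    have h3 : ψ (b - θ (φ b)) = 0 := hJψ (hle h1)
    rw [map_sub, h2, zero_sub, neg_eq_zero] at h3
    exact (hψθ (φ b)).symm.trans h3
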